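/- **Setting.** Let $\mathcal X\subset\mathbb R^{d}$ and $\Xi\subset\mathbb R^{e}$ be finite sets and $\mathcal A$ a finite set of actions. Let $P^0_x$ be a probability distribution on $\mathcal X$, let $\pi_0(\cdot|x)$ and $\pi(\cdot|x)$ (the behavior policy and the evaluation policy) be probability distributions on $\mathcal A$ for each $x\in\mathcal X$, let $P^0_{\Xi_{x,a}}$ be a probability distribution on $\Xi$ and $y_{x,a}:\Xi\to[0,Y_{\max}]$ a cost function for each $(x,a)\in\mathcal X\times\mathcal A$. Assume $\pi_0(a|x)\ge\mu_{\pi_0}>0$ and $P^0_x(x)\ge\mu_{x_0}>0$ for all $(x,a)$. The data $(X_i,A_i,\xi_i)$, $i=1,\dots,n$, are i.i.d. with $X_i\sim P^0_x$, $A_i\sim\pi_0(\cdot|X_i)$, $\xi_i\sim P^0_{\Xi_{X_i,A_i}}$ (the observed cost is $Y_i=y_{X_i,A_i}(\xi_i)$). For probability distributions $P,Q$ on a finite set $S$ of points of a Euclidean space let $D(P,Q)$ be the minimum of $\mathbb E_{(s,t)\sim\sigma}\|s-t\|^2$ over all couplings $\sigma$ of $P$ and $Q$, and let $\mathcal U(\epsilon;P^0)$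 be the set of probability distributions $P$ on $S$ with $D(P^0,P)\le\epsilon$. For radii $\epsilon_x,\epsilon_c>0$ the distributionally robust policy value is $$V(\pi)=\sup_{P\in\mathcal U(\epsilon_x;P^0_x)}\mathbb E_{x\sim P}\,\mathbb E_{a\sim\pi(\cdot|x)}\Big[\sup_{Q\in\mathcal U(\epsilon_c;P^0_{\Xi_{x,a}})}\mathbb E_{\xi\sim Q}[y_{x,a}(\xi)]\Big].$$ Let $\hat P^0_x$ be the empirical distribution of $X_1,\dots,X_n$ and $\hat P^0_{\Xi_{x,a}}$ the empirical distribution of those $\xi_i$ with $(X_i,A_i)=(x,a)$ (the zero measure if there are none). The empirical policy value is $$\hat V(\pi)=\inf_{\lambda\ge0}\Big\{\epsilon_x\lambda+\mathbb E_{x\sim\hat P^0_x}\Big[\sup_{\zeta\in\mathcal X}\big(\mathbb E_{a\sim\pi(\cdot|\zeta)}[\hat m(\zeta,a)]-\lambda\|x-\zeta\|^2\big)\Big]\Big\},$$ $$\hat m(x,a)=\inf_{\lambda\ge0}\Big\{\epsilon_c\lambda+\mathbb E_{\xi\sim\hat P^0_{\Xi_{x,a}}}\Big[\sup_{\zeta\in\Xi}\big(y_{x,a}(\zeta)-\lambda\|\xi-\zeta\|^2\big)\Big]\Big\}.$$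 **Theorem.** Let $\delta\in(0,1)$ and $n\ge 2\log(4|\mathcal X||\mathcal A|/\delta)/(\mu_{\pi_0}\mu_{x_0})^2$. Then, with probability at least $1-\delta$, $$|\hat V(\pi)-V(\pi)|\le Y_{\max}\Bigg(\sqrt{\frac{2\log(2/\delta)}{n}}+\sqrt{\frac{|\mathcal X|}{n}}+\sqrt{\frac{4\log(4|\mathcal X||\mathcal A|/\delta)}{n\mu_{\pi_0}\mu_{x_0}}}+\sqrt{\frac{2|\Xi|}{n\mu_{\pi_0}\mu_{x_0}}}\Bigg).$$ Moreover, the right-hand side is at most $$C\sqrt{\frac{\log(|\mathcal X||\mathcal A|/\delta)}{n}}+C\sqrt{\frac{|\mathcal X|+|\Xi|}{n}}$$ for a constant $C\ge 0$ that depends only on $Y_{\max}$, $\mu_{\pi_0}$ and $\mu_{x_0}$; in particular neither bound depends on the radii $\epsilon_x,\epsilon_c$. -/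

import Mathlib

open MeasureTheory ProbabilityTheory

noncomputable section

/-- Expectation `E_{s ∼ P}[f s]` for a probability vector `P` on a finite type. -/
def expect {S : Type*} [Fintype S] (P f : S → ℝ) : ℝ := ∑ s, P s * f s

/-- Couplings of `P` and `Q`: probability vectors on `S × S` with first marginal `P`
and second marginal `Q`. -/
def couplings {S : Type*} [Fintype S] (P Q : S → ℝ) : Set (S × S → ℝ) :=
  {σ | σ ∈ stdSimplex ℝ (S × S) ∧ (∀ s, ∑ t, σ (s, t) = P s) ∧ (∀ t, ∑ s, σ (s, t) = Q t)}

/-- Wasserstein (optimal transport) distance, with transport cost `c(s, t) = ‖s - t‖²`, between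
two probability vectors on a finite set `S` of points of Euclidean space. -/
def wassersteinDist {d : ℕ} {S : Finset (EuclideanSpace ℝ (Fin d))} (P Q : S → ℝ) : ℝ :=
  sInf ((fun σ : S × S → ℝ => expect σ (fun z => ‖(z.1 : EuclideanSpace ℝ (Fin d)) - z.2‖ ^ 2)) ''
    couplings P Q)

/-- The uncertainty set `U(ε; P₀)`: all probability vectors on `S` within Wasserstein distance `ε`
of `P₀`. -/
def uncertaintySet {d : ℕ} {S : Finset (EuclideanSpace ℝ (Fin d))} (ε : ℝ) (P₀ : S → ℝ) :
    Set (S → ℝ) :=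
  {P | P ∈ stdSimplex ℝ S ∧ wassersteinDist P₀ P ≤ ε}

/-- The primal problem `sup_{P ∈ U(ε; P₀)} E_P[f]`. -/
def primalDRO {d : ℕ} {S : Finset (EuclideanSpace ℝ (Fin d))} (ε : ℝ) (P₀ f : S → ℝ) : ℝ :=
  sSup ((fun P : S → ℝ => expect P f) '' uncertaintySet ε P₀)

/-- The dual problem `inf_{lam ≥ 0} {ε lam + E_{s ∼ P₀}[sup_{ζ ∈ S} (f ζ - lam ‖s - ζ‖²)]}`. -/
def dualDRO {d : ℕ} {S : Finset (EuclideanSpace ℝ (Fin d))} (ε : ℝ) (P₀ f : S → ℝ) : ℝ :=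
  sInf ((fun lam : ℝ => ε * lam + expect P₀ (fun s =>
    ⨆ ζ : S, (f ζ - lam * ‖(s : EuclideanSpace ℝ (Fin d)) - ζ‖ ^ 2))) '' Set.Ici 0)

/-- The distributionally robust policy value `V(π)`:
`sup_{P ∈ U(εx; P₀)} E_{x ∼ P} E_{a ∼ π(·|x)} sup_{Q ∈ U(εc; Q₀ x a)} E_{ξ ∼ Q}[y_{x,a}(ξ)]`. -/
def policyValue {d e : ℕ} {𝒳 : Finset (EuclideanSpace ℝ (Fin d))}
    {Ξ : Finset (EuclideanSpace ℝ (Fin e))} {A : Type*} [Fintype A] (εx εc : ℝ)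
    (P₀ : 𝒳 → ℝ) (Q₀ : 𝒳 → A → Ξ → ℝ) (y : 𝒳 → A → Ξ → ℝ) (π : 𝒳 → A → ℝ) : ℝ :=
  primalDRO εx P₀ (fun x => expect (π x) (fun a => primalDRO εc (Q₀ x a) (y x a)))

open Classical in
/-- Empirical context distribution of a dataset of triples (context, action, `ξ`). -/
def empContext {X A Z : Type*} {n : ℕ} (D : Fin n → X × A × Z) (x : X) : ℝ :=
  ((Finset.univ.filter (fun i => (D i).1 = x)).card : ℝ) / n

open Classical in
/-- Empirical distribution of `ξ` among the samples with context `x` and action `a`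
(identically `0` if there is no such sample). -/
def empOutcome {X A Z : Type*} {n : ℕ} (D : Fin n → X × A × Z) (x : X) (a : A) (z : Z) : ℝ :=
  ((Finset.univ.filter (fun i => D i = (x, a, z))).card : ℝ) /
    ((Finset.univ.filter (fun i => (D i).1 = x ∧ (D i).2.1 = a)).card : ℝ)

/-- The empirical policy value: the two-level dual problem at the empirical distributions. -/
def empPolicyValue {d e : ℕ} {𝒳 : Finset (EuclideanSpace ℝ (Fin d))}
    {Ξ : Finset (EuclideanSpace ℝ (Fin e))} {A : Type*} [Fintype A] (εx εc : ℝ) {n : ℕ}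
    (D : Fin n → 𝒳 × A × Ξ) (y : 𝒳 → A → Ξ → ℝ) (π : 𝒳 → A → ℝ) : ℝ :=
  dualDRO εx (empContext D)
    (fun x => expect (π x) (fun a => dualDRO εc (empOutcome D x a) (y x a)))

/-- `D` is a logged dataset: the triples `(Xᵢ, Aᵢ, ξᵢ)` are independent, `Xᵢ ∼ P₀`,
`Aᵢ ∼ π₀(· | Xᵢ)` and `ξᵢ ∼ Q₀ Xᵢ Aᵢ`. -/
def IsLoggedData {X A Z Ω : Type*} [MeasurableSpace X] [MeasurableSpace A] [MeasurableSpace Z]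
    [MeasurableSpace Ω] (P₀ : X → ℝ) (π₀ : X → A → ℝ) (Q₀ : X → A → Z → ℝ)
    (μ : Measure Ω) {n : ℕ} (D : Fin n → Ω → X × A × Z) : Prop :=
  (∀ i, Measurable (D i)) ∧ iIndepFun D μ ∧
    ∀ i x a z, μ.real {ω | D i ω = (x, a, z)} = P₀ x * π₀ x a * Q₀ x a z

/-- The right-hand side of the finite-sample bound; `cX`, `cA`, `cZ` are the cardinalities of the
context set, the action set and the set `Ξ`. -/
def opeBound (Ymax μπ μx δ : ℝ) (n cX cA cZ : ℕ) : ℝ :=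
  Ymax * (√(2 * Real.log (2 / δ) / n) + √((cX : ℝ) / n) +
    √(4 * Real.log (4 * cX * cA / δ) / (n * (μπ * μx))) + √(2 * cZ / (n * (μπ * μx))))

end

/-!
Each distributionally robust value is the optimal value of a linear program over the transport plans
that leave the reference law at cost at most `ε`. Staying put is strictly feasible for `ε > 0`, so a
Lagrange multiplier exists and the value equals its dual. In the dual the reference law `P` enters
only through `E_P` of the `c`-transform of the objective, which takes values between the bounds of
the objective whatever the multiplier; the dual value is therefore Lipschitz in `P` for the total
variation distance and nonexpansive in the objective, uniformly in the radii.

It remains to bound the total variation distance between the empirical and the true laws. It is a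
maximum over the `2 ^ k` events of a `k`-point space, and each event is handled by Hoeffding's
inequality. The number of outcomes observed at a given context and action is random, but with high
probability it is at least half of `n` times the lower bound on the probability of that pair.
-/

section TotalVariation

variable {S : Type*}

/-- The total variation distance between two probability vectors, as the largest excess of
`P'`-mass over `P`-mass on an event; it is used for vectors of equal total mass only, where this
is symmetric in `P'` and `P`. -/
noncomputable def tvDist (P' P : S → ℝ) : ℝ := ⨆ U : Finset S, ∑ s ∈ U, (P' s - P s)

variable [Finite S]

theorem sum_sub_le_tvDist (P' P : S → ℝ) (U : Finset S) :
    ∑ s ∈ U, (P' s - P s) ≤ tvDist P' P :=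
  le_ciSup (f := fun U : Finset S => ∑ s ∈ U, (P' s - P s)) (Set.finite_range _).bddAbove U

theorem exists_sum_sub_eq_tvDist (P' P : S → ℝ) :
    ∃ U : Finset S, ∑ s ∈ U, (P' s - P s) = tvDist P' P :=
  exists_eq_ciSup_of_finite

end TotalVariation

section Expect

variable {S : Type*} [Fintype S] {P P' f g : S → ℝ} {a b r : ℝ}

theorem expect_mono (hP : ∀ s, 0 ≤ P s) (h : ∀ s, f s ≤ g s) : expect P f ≤ expect P g :=
  Finset.sum_le_sum fun s _ => mul_le_mul_of_nonneg_left (h s) (hP s)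

theorem expect_sub (P f g : S → ℝ) :
    expect P (fun s => f s - g s) = expect P f - expect P g := by
  simp [expect, mul_sub]

theorem expect_neg (P f : S → ℝ) : expect P (fun s => -f s) = -expect P f := by
  simp [expect]

theorem expect_const_mul (P f : S → ℝ) (k : ℝ) :
    expect P (fun s => k * f s) = k * expect P f := by
  simp only [expect, Finset.mul_sum, mul_left_comm]

theorem isLinearMap_expect (f : S → ℝ) : IsLinearMap ℝ fun P => expect P f where
  map_add P Q := by simp [expect, add_mul, Finset.sum_add_distrib]
  map_smul k P := by simp [expect, Finset.mul_sum, mul_assoc]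

theorem expect_mem_Icc (hP : P ∈ stdSimplex ℝ S) (hf : ∀ s, f s ∈ Set.Icc a b) :
    expect P f ∈ Set.Icc a b :=
  (convex_Icc a b).sum_mem (fun s _ => hP.1 s) hP.2 fun s _ => hf s

theorem abs_expect_sub_le (hP : P ∈ stdSimplex ℝ S) (h : ∀ s, |f s - g s| ≤ r) :
    |expect P f - expect P g| ≤ r := by
  rw [← expect_sub]
  exact abs_le.2 (expect_mem_Icc hP fun s => abs_le.1 (h s))

theorem nonempty_of_mem_stdSimplex (hP : P ∈ stdSimplex ℝ S) : Nonempty S := by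
  by_contra h
  rw [not_nonempty_iff] at h
  simpa using hP.2

theorem expect_sub_expect_le_mul_tvDist (hP : ∑ s, P' s = ∑ s, P s)
    (hg : ∀ s, g s ∈ Set.Icc a b) : expect P' g - expect P g ≤ (b - a) * tvDist P' P := by
  classical
  rcases isEmpty_or_nonempty S with hS | ⟨⟨s₀⟩⟩
  · simp [expect, tvDist, Finset.eq_empty_of_isEmpty]
  have hab : 0 ≤ b - a := sub_nonneg.2 ((hg s₀).1.trans (hg s₀).2)
  calc expect P' g - expect P g = ∑ s, (P' s - P s) * (g s - a) := by
        simp only [expect, sub_mul, mul_sub, Finset.sum_sub_distrib, ← Finset.sum_mul, hP]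
        ring
    _ ≤ ∑ s, if P s ≤ P' s then (b - a) * (P' s - P s) else 0 := by
        refine Finset.sum_le_sum fun s _ => ?_
        split_ifs with hs
        · nlinarith [(hg s).2]
        · nlinarith [(hg s).1]
    _ = (b - a) * ∑ s with P s ≤ P' s, (P' s - P s) := by
        rw [← Finset.sum_filter, ← Finset.mul_sum]
    _ ≤ (b - a) * tvDist P' P := mul_le_mul_of_nonneg_left (sum_sub_le_tvDist _ _ _) hab

theorem abs_expect_sub_expect_le_mul_tvDist (hP : ∑ s, P' s = ∑ s, P s)
    (hg : ∀ s, g s ∈ Set.Icc a b) : |expect P' g - expect P g| ≤ (b - a) * tvDist P' P := by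
  have hneg : ∀ s, -g s ∈ Set.Icc (-b) (-a) := fun s =>
    ⟨neg_le_neg (hg s).2, neg_le_neg (hg s).1⟩
  have hlower := expect_sub_expect_le_mul_tvDist hP hneg
  rw [expect_neg, expect_neg] at hlower
  refine abs_le.2 ⟨?_, expect_sub_expect_le_mul_tvDist hP hg⟩
  linarith

end Expect

section CTransform

variable {S : Type*} {c : S → S → ℝ} {f f' : S → ℝ} {a b lam r : ℝ}

/-- The `c`-transform of optimal transport: the largest value of `f`, penalized by `lam` times the
cost of moving there from `s`. -/
noncomputable def cTransform (c : S → S → ℝ) (lam : ℝ) (f : S → ℝ) (s : S) : ℝ :=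
  ⨆ ζ, (f ζ - lam * c s ζ)

variable [Finite S]

theorem sub_mul_le_cTransform (c : S → S → ℝ) (lam : ℝ) (f : S → ℝ) (s ζ : S) :
    f ζ - lam * c s ζ ≤ cTransform c lam f s :=
  le_ciSup (f := fun ζ => f ζ - lam * c s ζ) (Set.finite_range _).bddAbove ζ

theorem le_cTransform (hc : ∀ s, c s s = 0) (lam : ℝ) (f : S → ℝ) (s : S) :
    f s ≤ cTransform c lam f s := by
  simpa [hc] using sub_mul_le_cTransform c lam f s s

theorem cTransform_mem_Icc (hc : ∀ s, c s s = 0) (hc' : ∀ s t, 0 ≤ c s t) (hlam : 0 ≤ lam)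
    (hf : ∀ s, f s ∈ Set.Icc a b) (s : S) : cTransform c lam f s ∈ Set.Icc a b := by
  have : Nonempty S := ⟨s⟩
  refine ⟨(hf s).1.trans (le_cTransform hc lam f s), ciSup_le fun ζ => ?_⟩
  linarith [(hf ζ).2, mul_nonneg hlam (hc' s ζ)]

theorem abs_cTransform_sub_le (c : S → S → ℝ) (lam : ℝ) (h : ∀ s, |f s - f' s| ≤ r) (s : S) :
    |cTransform c lam f s - cTransform c lam f' s| ≤ r := by
  have : Nonempty S := ⟨s⟩
  rw [abs_sub_le_iff, sub_le_iff_le_add, sub_le_iff_le_add]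
  constructor <;> refine ciSup_le fun ζ => ?_
  · linarith [(abs_sub_le_iff.1 (h ζ)).1, sub_mul_le_cTransform c lam f' s ζ]
  · linarith [(abs_sub_le_iff.1 (h ζ)).2, sub_mul_le_cTransform c lam f s ζ]

end CTransform

section TransportDual

variable {S : Type*} [Fintype S] {c : S → S → ℝ} {P P' f f' : S → ℝ} {a b ε lam r : ℝ}

/-- The Lagrangian dual function of the problem of maximizing `f` in expectation at the end of a
transport from `P` of cost at most `ε`. -/
noncomputable def dualObjective (c : S → S → ℝ) (ε : ℝ) (P f : S → ℝ) (lam : ℝ) : ℝ :=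
  ε * lam + expect P (cTransform c lam f)

/-- The optimal value of the Lagrangian dual, for an arbitrary transport cost `c`. -/
noncomputable def transportDual (c : S → S → ℝ) (ε : ℝ) (P f : S → ℝ) : ℝ :=
  sInf (dualObjective c ε P f '' Set.Ici 0)

theorem expect_le_dualObjective (hc : ∀ s, c s s = 0) (hε : 0 ≤ ε) (hP : ∀ s, 0 ≤ P s)
    (f : S → ℝ) (hlam : 0 ≤ lam) : expect P f ≤ dualObjective c ε P f lam :=
  (expect_mono hP (le_cTransform hc lam f)).trans (le_add_of_nonneg_left (mul_nonneg hε hlam))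

theorem bddBelow_dualObjective (hc : ∀ s, c s s = 0) (hε : 0 ≤ ε) (hP : ∀ s, 0 ≤ P s)
    (f : S → ℝ) : BddBelow (dualObjective c ε P f '' Set.Ici 0) :=
  ⟨expect P f, Set.forall_mem_image.2 fun _ => expect_le_dualObjective hc hε hP f⟩

theorem transportDual_mem_Icc (hc : ∀ s, c s s = 0) (hc' : ∀ s t, 0 ≤ c s t) (hε : 0 ≤ ε)
    (hP : P ∈ stdSimplex ℝ S) (hf : ∀ s, f s ∈ Set.Icc a b) :
    transportDual c ε P f ∈ Set.Icc a b := by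
  constructor
  · refine le_csInf (Set.nonempty_Ici.image _) (Set.forall_mem_image.2 fun lam hlam => ?_)
    exact (expect_mem_Icc hP hf).1.trans (expect_le_dualObjective hc hε hP.1 f hlam)
  · calc transportDual c ε P f ≤ dualObjective c ε P f 0 :=
          csInf_le (bddBelow_dualObjective hc hε hP.1 f) ⟨0, Set.self_mem_Ici, rfl⟩
      _ = expect P (cTransform c 0 f) := by rw [dualObjective, mul_zero, zero_add]
      _ ≤ b := (expect_mem_Icc hP (cTransform_mem_Icc hc hc' le_rfl hf)).2

theorem sInf_image_sub_sInf_image_le {α : Type*} {K : Set α} (hK : K.Nonempty) {F G : α → ℝ}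
    (hF : BddBelow (F '' K)) (h : ∀ x ∈ K, F x - G x ≤ r) : sInf (F '' K) - sInf (G '' K) ≤ r := by
  rw [sub_le_comm]
  refine le_csInf (hK.image G) (Set.forall_mem_image.2 fun x hx => ?_)
  linarith [h x hx, csInf_le hF (Set.mem_image_of_mem F hx)]

theorem abs_transportDual_sub_le (hc : ∀ s, c s s = 0) (hε : 0 ≤ ε) (hP : ∀ s, 0 ≤ P s)
    (hP' : ∀ s, 0 ≤ P' s) (h : ∀ lam, 0 ≤ lam →
      |expect P (cTransform c lam f) - expect P' (cTransform c lam f')| ≤ r) :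
    |transportDual c ε P f - transportDual c ε P' f'| ≤ r := by
  have hdiff {R R' g g' : S → ℝ} {lam : ℝ}
      (hr : expect R (cTransform c lam g) - expect R' (cTransform c lam g') ≤ r) :
      dualObjective c ε R g lam - dualObjective c ε R' g' lam ≤ r :=
    (add_sub_add_left_eq_sub _ _ _).trans_le hr
  exact abs_sub_le_iff.2
    ⟨sInf_image_sub_sInf_image_le Set.nonempty_Ici (bddBelow_dualObjective hc hε hP f)
      fun lam hlam => hdiff (abs_sub_le_iff.1 (h lam hlam)).1,
    sInf_image_sub_sInf_image_le Set.nonempty_Ici (bddBelow_dualObjective hc hε hP' f')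
      fun lam hlam => hdiff (abs_sub_le_iff.1 (h lam hlam)).2⟩

theorem abs_transportDual_sub_le_mul_tvDist (hc : ∀ s, c s s = 0) (hc' : ∀ s t, 0 ≤ c s t)
    (hε : 0 ≤ ε) (hP' : P' ∈ stdSimplex ℝ S) (hP : P ∈ stdSimplex ℝ S)
    (hf : ∀ s, f s ∈ Set.Icc a b) :
    |transportDual c ε P' f - transportDual c ε P f| ≤ (b - a) * tvDist P' P :=
  abs_transportDual_sub_le hc hε hP'.1 hP.1 fun _ hlam =>
    abs_expect_sub_expect_le_mul_tvDist (hP'.2.trans hP.2.symm)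
      (cTransform_mem_Icc hc hc' hlam hf)

theorem abs_transportDual_sub_le_of_abs_sub_le (hc : ∀ s, c s s = 0) (hε : 0 ≤ ε)
    (hP : P ∈ stdSimplex ℝ S) (h : ∀ s, |f s - f' s| ≤ r) :
    |transportDual c ε P f - transportDual c ε P f'| ≤ r :=
  abs_transportDual_sub_le hc hε hP.1 hP.1 fun lam _ =>
    abs_expect_sub_le hP (abs_cTransform_sub_le c lam h)

end TransportDual

section StrongDuality

theorem div_sub_le_div_sub_of_convex {K : Set (ℝ × ℝ)} (hK : Convex ℝ K) {ε v : ℝ}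
    (hv : ∀ p ∈ K, p.1 ≤ ε → p.2 ≤ v) {p q : ℝ × ℝ} (hp : p ∈ K) (hpε : p.1 < ε) (hq : q ∈ K)
    (hqε : ε < q.1) : (q.2 - v) / (q.1 - ε) ≤ (v - p.2) / (ε - p.1) := by
  have hp' : 0 < ε - p.1 := sub_pos.2 hpε
  have hq' : 0 < q.1 - ε := sub_pos.2 hqε
  have hpq : 0 < q.1 - p.1 := by linarith
  have hcross := hv _ (hK hp hq (a := (q.1 - ε) / (q.1 - p.1)) (b := (ε - p.1) / (q.1 - p.1))
    (by positivity) (by positivity) (by field_simp; ring)) (le_of_eq (by simp; field_simp; ring))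
  have hcross' : (q.1 - ε) * p.2 + (ε - p.1) * q.2 ≤ v * (q.1 - p.1) := by
    rw [← div_le_iff₀ hpq]
    refine le_trans (le_of_eq ?_) hcross
    simp only [Prod.snd_add, Prod.smul_snd, smul_eq_mul]
    ring
  rw [div_le_div_iff₀ hq' hp']
  linarith

theorem exists_multiplier_of_convex {K : Set (ℝ × ℝ)} (hK : Convex ℝ K) {ε v : ℝ}
    (hv : ∀ p ∈ K, p.1 ≤ ε → p.2 ≤ v) (hslater : ∃ p ∈ K, p.1 < ε) :
    ∃ lam : ℝ, 0 ≤ lam ∧ ∀ p ∈ K, p.2 + lam * (ε - p.1) ≤ v := by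
  -- The multiplier is any slope between the chords from `(ε, v)` to the two sides of `K`.
  obtain ⟨lam, hright, hleft⟩ := exists_between_of_forall_le
    (s := insert 0 ((fun q : ℝ × ℝ => (q.2 - v) / (q.1 - ε)) '' {q ∈ K | ε < q.1}))
    (t := (fun p : ℝ × ℝ => (v - p.2) / (ε - p.1)) '' {p ∈ K | p.1 < ε})
    (Set.insert_nonempty _ _) (Set.Nonempty.image _ hslater) (by
      rintro _ (rfl | ⟨q, ⟨hq, hqε⟩, rfl⟩) _ ⟨p, ⟨hp, hpε⟩, rfl⟩
      · exact div_nonneg (sub_nonneg.2 (hv p hp hpε.le)) (sub_pos.2 hpε).le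
      · exact div_sub_le_div_sub_of_convex hK hv hp hpε hq hqε)
  refine ⟨lam, hright (Set.mem_insert _ _), fun p hp => ?_⟩
  rcases lt_trichotomy p.1 ε with h | h | h
  · have := hleft ⟨p, ⟨hp, h⟩, rfl⟩
    rw [le_div_iff₀ (sub_pos.2 h)] at this
    linarith
  · simpa [h] using hv p hp h.le
  · have := hright (Set.mem_insert_of_mem 0 ⟨p, ⟨hp, h⟩, rfl⟩)
    rw [div_le_iff₀ (sub_pos.2 h)] at this
    linarith

variable {S : Type*} [Fintype S] {c : S → S → ℝ} {P Q f : S → ℝ} {ε lam : ℝ}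

/-- The transport plans that start from `P`: the couplings of `P` with an unspecified second
marginal. -/
def plansFrom (P : S → ℝ) : Set (S × S → ℝ) :=
  {σ | σ ∈ stdSimplex ℝ (S × S) ∧ ∀ s, ∑ t, σ (s, t) = P s}

theorem convex_plansFrom (P : S → ℝ) : Convex ℝ (plansFrom P) := by
  intro σ hσ τ hτ a b ha hb hab
  refine ⟨convex_stdSimplex ℝ _ hσ.1 hτ.1 ha hb hab, fun s => ?_⟩
  simp only [Pi.add_apply, Pi.smul_apply, smul_eq_mul, Finset.sum_add_distrib, ← Finset.mul_sum,
    hσ.2, hτ.2, ← add_mul, hab, one_mul]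

theorem expect_fst_of_mem_plansFrom {σ : S × S → ℝ} (hσ : σ ∈ plansFrom P) (g : S → ℝ) :
    expect σ (fun z => g z.1) = expect P g := by
  simp only [expect, Fintype.sum_prod_type, ← Finset.sum_mul, hσ.2]

theorem expect_snd_marginal (σ : S × S → ℝ) (f : S → ℝ) :
    expect (fun t => ∑ s, σ (s, t)) f = expect σ fun z => f z.2 := by
  simp only [expect, Finset.sum_mul, Fintype.sum_prod_type]
  exact Finset.sum_comm

theorem exists_mem_plansFrom_of_map (hP : P ∈ stdSimplex ℝ S) (T : S → S) :
    ∃ σ ∈ plansFrom P, ∀ k : S × S → ℝ, expect σ k = expect P fun s => k (s, T s) := by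
  classical
  refine ⟨fun z => if z.2 = T z.1 then P z.1 else 0, ⟨⟨fun z => ?_, ?_⟩, fun s => ?_⟩, fun k => ?_⟩
  · dsimp only
    split_ifs
    exacts [hP.1 _, le_rfl]
  · simpa [Fintype.sum_prod_type] using hP.2
  · simp
  · simp [expect, Fintype.sum_prod_type, ite_mul]

theorem expect_snd_le_dualObjective {σ : S × S → ℝ} (hσ : σ ∈ plansFrom P)
    (hcost : expect σ (fun z => c z.1 z.2) ≤ ε) (hlam : 0 ≤ lam) (f : S → ℝ) :
    expect σ (fun z => f z.2) ≤ dualObjective c ε P f lam := by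
  have hpen : expect σ (fun z => f z.2 - lam * c z.1 z.2) ≤ expect P (cTransform c lam f) :=
    (expect_mono hσ.1.1 fun z => sub_mul_le_cTransform c lam f z.1 z.2).trans_eq
      (expect_fst_of_mem_plansFrom hσ _)
  rw [expect_sub, expect_const_mul] at hpen
  rw [dualObjective]
  linarith [mul_le_mul_of_nonneg_left hcost hlam]

theorem dualObjective_eq_expect_of_map {T : S → S}
    (hT : ∀ s, f (T s) - lam * c s (T s) = cTransform c lam f s) :
    dualObjective c ε P f lam =
      expect P (fun s => f (T s)) + lam * (ε - expect P fun s => c s (T s)) := by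
  rw [dualObjective, ← funext hT, expect_sub, expect_const_mul]
  ring

theorem isLUB_transportDual (hc : ∀ s, c s s = 0) (hε : 0 < ε) (hP : P ∈ stdSimplex ℝ S)
    (f : S → ℝ) :
    IsLUB ((fun σ => expect σ fun z => f z.2) ''
      {σ ∈ plansFrom P | expect σ (fun z => c z.1 z.2) ≤ ε}) (transportDual c ε P f) := by
  constructor
  · rintro _ ⟨σ, ⟨hσ, hcost⟩, rfl⟩
    exact le_csInf (Set.nonempty_Ici.image _) (Set.forall_mem_image.2 fun lam hlam =>
      expect_snd_le_dualObjective hσ hcost hlam f)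
  · intro v hv
    let φ : (S × S → ℝ) → ℝ × ℝ := fun σ => (expect σ fun z => c z.1 z.2, expect σ fun z => f z.2)
    have hφ : IsLinearMap ℝ φ :=
      ⟨fun σ τ => Prod.ext ((isLinearMap_expect _).map_add σ τ)
          ((isLinearMap_expect _).map_add σ τ),
        fun k σ => Prod.ext ((isLinearMap_expect _).map_smul k σ)
          ((isLinearMap_expect _).map_smul k σ)⟩
    obtain ⟨σ₀, hσ₀, hstay⟩ := exists_mem_plansFrom_of_map hP id
    have hslater : expect σ₀ (fun z => c z.1 z.2) < ε := by
      rw [hstay]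
      simpa [hc, expect] using hε
    obtain ⟨lam, hlam, hmul⟩ := exists_multiplier_of_convex
      ((convex_plansFrom P).is_linear_image hφ) (ε := ε) (v := v)
      (Set.forall_mem_image.2 fun σ hσ hcost => hv ⟨σ, ⟨hσ, hcost⟩, rfl⟩)
      ⟨φ σ₀, Set.mem_image_of_mem φ hσ₀, hslater⟩
    have := nonempty_of_mem_stdSimplex hP
    choose T hT using fun s : S =>
      exists_eq_ciSup_of_finite (f := fun ζ => f ζ - lam * c s ζ)
    obtain ⟨σ, hσ, hmove⟩ := exists_mem_plansFrom_of_map hP T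
    calc transportDual c ε P f ≤ dualObjective c ε P f lam :=
          csInf_le (bddBelow_dualObjective hc hε.le hP.1 f) ⟨lam, hlam, rfl⟩
      _ = expect σ (fun z => f z.2) + lam * (ε - expect σ fun z => c z.1 z.2) := by
          rw [dualObjective_eq_expect_of_map hT, hmove, hmove]
      _ ≤ v := hmul _ ⟨σ, hσ, rfl⟩

theorem couplings_nonempty (hP : P ∈ stdSimplex ℝ S) (hQ : Q ∈ stdSimplex ℝ S) :
    (couplings P Q).Nonempty := by
  refine ⟨fun z => P z.1 * Q z.2, ⟨fun z => mul_nonneg (hP.1 _) (hQ.1 _), ?_⟩, fun s => ?_,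
    fun t => ?_⟩
  · simp only [Fintype.sum_prod_type, ← Finset.mul_sum, hP.2, hQ.2, mul_one]
  · simp only [← Finset.mul_sum, hQ.2, mul_one]
  · simp only [← Finset.sum_mul, hP.2, one_mul]

theorem isCompact_couplings (P Q : S → ℝ) : IsCompact (couplings P Q) := by
  have hclosed (r : (S × S → ℝ) → S → ℝ) (hr : Continuous r) (R : S → ℝ) :
      IsClosed {σ | ∀ s, r σ s = R s} := by
    simpa only [funext_iff] using isClosed_eq hr continuous_const (g := fun _ => R)
  exact (isCompact_stdSimplex ℝ (S × S)).inter_right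
    ((hclosed (fun σ s => ∑ t, σ (s, t)) (by fun_prop) P).inter
      (hclosed (fun σ t => ∑ s, σ (s, t)) (by fun_prop) Q))

end StrongDuality

section Wasserstein

variable {d e : ℕ} {S : Finset (EuclideanSpace ℝ (Fin d))} {P Q f : S → ℝ} {ε : ℝ}

/-- The transport cost `‖s - t‖²` behind `wassersteinDist` and `dualDRO`. -/
noncomputable def sqDist (s t : S) : ℝ := ‖(s : EuclideanSpace ℝ (Fin d)) - t‖ ^ 2

theorem sqDist_self (s : S) : sqDist s s = 0 := by simp [sqDist]

theorem sqDist_nonneg (s t : S) : 0 ≤ sqDist s t := sq_nonneg _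

theorem dualDRO_eq_transportDual (ε : ℝ) (P f : S → ℝ) :
    dualDRO ε P f = transportDual sqDist ε P f := rfl

theorem mem_uncertaintySet_iff (hP : P ∈ stdSimplex ℝ S) :
    Q ∈ uncertaintySet ε P ↔
      ∃ σ ∈ couplings P Q, expect σ (fun z => sqDist z.1 z.2) ≤ ε := by
  have hcont : Continuous fun σ : S × S → ℝ => expect σ fun z => sqDist z.1 z.2 := by
    unfold expect
    fun_prop
  constructor
  · rintro ⟨hQ, hW⟩
    obtain ⟨σ, hσ, hmin⟩ := (isCompact_couplings P Q).exists_sInf_image_eq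
      (couplings_nonempty hP hQ) hcont.continuousOn
    exact ⟨σ, hσ, hmin.symm.trans_le hW⟩
  · rintro ⟨σ, hσ, hcost⟩
    refine ⟨⟨fun t => ?_, ?_⟩, ?_⟩
    · rw [← hσ.2.2]
      exact Finset.sum_nonneg fun s _ => hσ.1.1 _
    · simp only [← hσ.2.2]
      rw [Finset.sum_comm, ← Fintype.sum_prod_type, hσ.1.2]
    · exact (csInf_le ((isCompact_couplings P Q).bddBelow_image hcont.continuousOn)
        ⟨σ, hσ, rfl⟩).trans hcost

theorem expect_image_uncertaintySet (hP : P ∈ stdSimplex ℝ S) (f : S → ℝ) :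
    (fun Q => expect Q f) '' uncertaintySet ε P =
      (fun σ => expect σ fun z => f z.2) ''
        {σ ∈ plansFrom P | expect σ (fun z => sqDist z.1 z.2) ≤ ε} := by
  ext v
  constructor
  · rintro ⟨Q, hQ, rfl⟩
    obtain ⟨σ, hσ, hcost⟩ := (mem_uncertaintySet_iff hP).1 hQ
    refine ⟨σ, ⟨⟨hσ.1, hσ.2.1⟩, hcost⟩, ?_⟩
    simp only [← expect_snd_marginal, hσ.2.2]
  · rintro ⟨σ, ⟨hσ, hcost⟩, rfl⟩
    exact ⟨fun t => ∑ s, σ (s, t),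
      (mem_uncertaintySet_iff hP).2 ⟨σ, ⟨hσ.1, hσ.2, fun _ => rfl⟩, hcost⟩,
      expect_snd_marginal σ f⟩

theorem primalDRO_eq_dualDRO (hε : 0 < ε) (hP : P ∈ stdSimplex ℝ S) (f : S → ℝ) :
    primalDRO ε P f = dualDRO ε P f := by
  have hlub := isLUB_transportDual sqDist_self hε hP f
  rw [primalDRO, expect_image_uncertaintySet hP, dualDRO_eq_transportDual]
  refine hlub.csSup_eq ?_
  obtain ⟨σ, hσ, hstay⟩ := exists_mem_plansFrom_of_map hP id
  refine Set.Nonempty.image _ ⟨σ, hσ, ?_⟩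
  rw [hstay]
  simpa [sqDist_self, expect] using hε.le

variable {𝒳 : Finset (EuclideanSpace ℝ (Fin d))} {Ξ : Finset (EuclideanSpace ℝ (Fin e))}
  {A : Type*} [Fintype A] {εx εc l u t : ℝ} {P' P₀ : 𝒳 → ℝ} {Q' Q₀ y : 𝒳 → A → Ξ → ℝ}
  {π : 𝒳 → A → ℝ}

theorem policyValue_eq_dualDRO (hεx : 0 < εx) (hεc : 0 < εc) (hP₀ : P₀ ∈ stdSimplex ℝ 𝒳)
    (hQ₀ : ∀ x a, Q₀ x a ∈ stdSimplex ℝ Ξ) :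
    policyValue εx εc P₀ Q₀ y π =
      dualDRO εx P₀ fun x => expect (π x) fun a => dualDRO εc (Q₀ x a) (y x a) := by
  simp only [policyValue, primalDRO_eq_dualDRO hεc (hQ₀ _ _), primalDRO_eq_dualDRO hεx hP₀]

theorem abs_dualDRO_sub_policyValue_le (hεx : 0 < εx) (hεc : 0 < εc)
    (hP' : P' ∈ stdSimplex ℝ 𝒳) (hP₀ : P₀ ∈ stdSimplex ℝ 𝒳)
    (hQ' : ∀ x a, Q' x a ∈ stdSimplex ℝ Ξ) (hQ₀ : ∀ x a, Q₀ x a ∈ stdSimplex ℝ Ξ)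
    (hπ : ∀ x, π x ∈ stdSimplex ℝ A) (hy : ∀ x a ξ, y x a ξ ∈ Set.Icc l u)
    (ht : ∀ x a, tvDist (Q' x a) (Q₀ x a) ≤ t) :
    |dualDRO εx P' (fun x => expect (π x) fun a => dualDRO εc (Q' x a) (y x a)) -
      policyValue εx εc P₀ Q₀ y π| ≤ (u - l) * (tvDist P' P₀ + t) := by
  rw [policyValue_eq_dualDRO hεx hεc hP₀ hQ₀]
  simp only [dualDRO_eq_transportDual]
  have hinner (x : 𝒳) (a : A) : |transportDual sqDist εc (Q' x a) (y x a) -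
      transportDual sqDist εc (Q₀ x a) (y x a)| ≤ (u - l) * t := by
    obtain ⟨ξ⟩ := nonempty_of_mem_stdSimplex (hQ₀ x a)
    have hlu : 0 ≤ u - l := sub_nonneg.2 ((hy x a ξ).1.trans (hy x a ξ).2)
    exact (abs_transportDual_sub_le_mul_tvDist sqDist_self sqDist_nonneg hεc.le (hQ' x a)
      (hQ₀ x a) (hy x a)).trans (mul_le_mul_of_nonneg_left (ht x a) hlu)
  have hlaw := abs_transportDual_sub_le_mul_tvDist sqDist_self sqDist_nonneg hεx.le hP' hP₀
    fun x => expect_mem_Icc (hπ x) fun a =>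
      transportDual_mem_Icc sqDist_self sqDist_nonneg hεc.le (hQ' x a) (hy x a)
  have hcost := abs_transportDual_sub_le_of_abs_sub_le sqDist_self hεx.le hP₀
    fun x => abs_expect_sub_le (hπ x) (hinner x)
  rw [mul_add]
  exact (abs_sub_le _ _ _).trans (add_le_add hlaw hcost)

end Wasserstein

section Concentration

variable {ι T Ω : Type*} [Fintype ι] [MeasurableSpace T] [MeasurableSpace Ω] {μ : Measure Ω}
  {β t m r : ℝ}

theorem convex_comb_exp_le (hβ : β ∈ Set.Icc (0 : ℝ) 1) (lam : ℝ) :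
    β * Real.exp (lam * (1 - β)) + (1 - β) * Real.exp (-(lam * β)) ≤ Real.exp (lam ^ 2 / 8) := by
  let p : unitInterval := ⟨β, hβ⟩
  have hmean : ∫ x, x ∂(bernoulliMeasure (1 - β) (-β) p) = 0 := by
    rw [integral_bernoulliMeasure]
    change β * (1 - β) + (1 - β) * -β = 0
    ring
  have hrange : ∀ᵐ x ∂(bernoulliMeasure (1 - β) (-β) p), x ∈ Set.Icc (-β) (1 - β) :=
    ae_add_measure_iff.2 ⟨Measure.ae_smul_measure (by simp [ae_dirac_eq]) _,
      Measure.ae_smul_measure (by simp [ae_dirac_eq]) _⟩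
  have hoeffding := (hasSubgaussianMGF_of_mem_Icc_of_integral_eq_zero aemeasurable_id hrange
    hmean).mgf_le lam
  rw [mgf, integral_bernoulliMeasure] at hoeffding
  simp only [id_eq, smul_eq_mul, mul_neg, sub_neg_eq_add, sub_add_cancel, nnnorm_one, one_div,
    inv_pow, NNReal.coe_inv, NNReal.coe_pow, NNReal.coe_ofNat, p] at hoeffding
  convert hoeffding using 2
  ring

theorem measureReal_le_sum_le_exp_neg [IsFiniteMeasure μ] {X : ι → Ω → ℝ}
    (hmeas : ∀ i, Measurable (X i)) (hindep : iIndepFun X μ)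
    (hint : ∀ i, Integrable (fun ω => Real.exp (1 * X i ω)) μ) (hmgf : ∀ i, mgf (X i) μ 1 ≤ 1)
    (s : ℝ) :
    μ.real {ω | s ≤ ∑ i, X i ω} ≤ Real.exp (-s) := by
  have hchernoff := measure_ge_le_exp_mul_mgf s zero_le_one
    (hindep.integrable_exp_mul_sum hmeas (s := Finset.univ) fun i _ => hint i)
  rw [hindep.mgf_sum hmeas] at hchernoff
  simp only [Finset.sum_apply, neg_mul, one_mul] at hchernoff
  exact hchernoff.trans (mul_le_of_le_one_right (Real.exp_pos _).le
    (Finset.prod_le_one (fun i _ => mgf_nonneg) fun i _ => hmgf i))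

theorem exp_mul_indicator_sub_mul_indicator {α : Type*} {G B : Set α} (hBG : B ⊆ G) (u v : ℝ)
    (x : α) : Real.exp (u * B.indicator 1 x - v * G.indicator 1 x) =
      1 + (Real.exp (-v) - 1) * G.indicator 1 x +
        (Real.exp (u - v) - Real.exp (-v)) * B.indicator 1 x := by
  by_cases hB : x ∈ B
  · simp [hB, hBG hB]
  · by_cases hG : x ∈ G <;> simp [hB, hG]

theorem integrable_const_mul_indicator_one [IsFiniteMeasure μ] {G : Set Ω} (hG : MeasurableSet G)
    (k : ℝ) :
    Integrable (fun ω => k * G.indicator (1 : Ω → ℝ) ω) μ :=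
  ((integrable_const (1 : ℝ)).indicator hG).const_mul k

theorem integrable_exp_mul_indicator_sub_mul_indicator [IsFiniteMeasure μ] {G B : Set Ω}
    (hG : MeasurableSet G) (hB : MeasurableSet B) (hBG : B ⊆ G) (u v : ℝ) :
    Integrable (fun ω => Real.exp (1 * (u * B.indicator 1 ω - v * G.indicator 1 ω))) μ := by
  simp only [one_mul, exp_mul_indicator_sub_mul_indicator hBG]
  exact ((integrable_const 1).add (integrable_const_mul_indicator_one hG _)).add
    (integrable_const_mul_indicator_one hB _)

theorem mgf_mul_indicator_sub_mul_indicator [IsProbabilityMeasure μ] {G B : Set Ω}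
    (hG : MeasurableSet G) (hB : MeasurableSet B) (hBG : B ⊆ G) (u v : ℝ) :
    mgf (fun ω => u * B.indicator 1 ω - v * G.indicator 1 ω) μ 1 =
      1 + (Real.exp (-v) - 1) * μ.real G + (Real.exp (u - v) - Real.exp (-v)) * μ.real B := by
  have hint {H : Set Ω} (hH : MeasurableSet H) (k : ℝ) :=
    integrable_const_mul_indicator_one (μ := μ) hH k
  simp only [mgf, one_mul, exp_mul_indicator_sub_mul_indicator hBG]
  rw [integral_add ?_ (hint hB _), integral_add (integrable_const 1) (hint hG _),
    integral_const_mul, integral_const_mul,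
    integral_indicator_one hG, integral_indicator_one hB]
  · simp
  · exact (integrable_const 1).add (hint hG _)

theorem mgf_excess_le_one [IsProbabilityMeasure μ] {G B : Set Ω} (hG : MeasurableSet G)
    (hB : MeasurableSet B) (hBG : B ⊆ G) (hβ : β ∈ Set.Icc (0 : ℝ) 1)
    (hprob : μ.real B ≤ β * μ.real G) (ht : 0 ≤ t) :
    mgf (fun ω => 4 * t * B.indicator 1 ω - (4 * t * β + 2 * t ^ 2) * G.indicator 1 ω) μ 1 ≤ 1 := by
  -- `4 * t` is the minimizer of Hoeffding's exponent `lam ^ 2 / 8 - lam * t`.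
  rw [mgf_mul_indicator_sub_mul_indicator hG hB hBG]
  set v : ℝ := 4 * t * β + 2 * t ^ 2 with hv
  have hmono : Real.exp (-v) ≤ Real.exp (4 * t - v) := Real.exp_le_exp.2 (by linarith)
  have hconvex : β * Real.exp (4 * t - v) + (1 - β) * Real.exp (-v) ≤ 1 := calc
      β * Real.exp (4 * t - v) + (1 - β) * Real.exp (-v)
      _ = (β * Real.exp (4 * t * (1 - β)) + (1 - β) * Real.exp (-(4 * t * β))) *
          Real.exp (-(2 * t ^ 2)) := by
        rw [add_mul, mul_assoc β, mul_assoc (1 - β), ← Real.exp_add, ← Real.exp_add, hv]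
        ring_nf
      _ ≤ Real.exp ((4 * t) ^ 2 / 8) * Real.exp (-(2 * t ^ 2)) :=
        mul_le_mul_of_nonneg_right (convex_comb_exp_le hβ (4 * t)) (Real.exp_pos _).le
      _ = 1 := by
        rw [← Real.exp_add, Real.exp_eq_one_iff]
        ring
  nlinarith [mul_le_mul_of_nonneg_left hprob (sub_nonneg.2 hmono),
    mul_le_mul_of_nonneg_left hconvex (measureReal_nonneg (μ := μ) (s := G))]

open Classical in
/-- The number of samples `D i` that lie in `G`, as a real number. -/
noncomputable def hitCount {T : Type*} (D : ι → T) (G : Set T) : ℝ :=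
  (Finset.univ.filter fun i => D i ∈ G).card

theorem hitCount_eq_sum_indicator {T : Type*} (D : ι → T) (G : Set T) :
    hitCount D G = ∑ i, G.indicator 1 (D i) := by
  classical
  simp [hitCount, Set.indicator_apply]

theorem hitCount_univ {T : Type*} (D : ι → T) : hitCount D Set.univ = Fintype.card ι := by
  simp [hitCount]

theorem hitCount_compl {T : Type*} (D : ι → T) (G : Set T) :
    hitCount D Gᶜ = Fintype.card ι - hitCount D G := by
  simp [hitCount_eq_sum_indicator, Set.indicator_compl]

theorem sum_hitCount_inter_preimage {T Z : Type*} (D : ι → T) (G : Set T) (f : T → Z)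
    (U : Finset Z) :
    ∑ z ∈ U, hitCount D (G ∩ f ⁻¹' {z}) = hitCount D (G ∩ f ⁻¹' U) := by
  classical
  simp only [hitCount_eq_sum_indicator]
  rw [Finset.sum_comm]
  refine Finset.sum_congr rfl fun i _ => ?_
  by_cases hi : D i ∈ G <;> simp [Set.indicator_apply, hi]

/-- Hoeffding's inequality for a sample of random size: a sample outside `G` contributes the factor
`1` to the exponential moment, so there is no need to condition on the size. -/
theorem measureReal_mul_hitCount_le_hitCount_le [IsProbabilityMeasure μ] {D : ι → Ω → T}
    (hD : ∀ i, Measurable (D i)) (hindep : iIndepFun D μ) {G B : Set T} (hG : MeasurableSet G)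
    (hB : MeasurableSet B) (hBG : B ⊆ G) (hβ : β ∈ Set.Icc (0 : ℝ) 1)
    (hprob : ∀ i, μ.real (D i ⁻¹' B) ≤ β * μ.real (D i ⁻¹' G)) (ht : 0 ≤ t) :
    μ.real {ω | m ≤ hitCount (fun i => D i ω) G ∧
        (β + t) * hitCount (fun i => D i ω) G ≤ hitCount (fun i => D i ω) B} ≤
      Real.exp (-(2 * m * t ^ 2)) := by
  let φ : T → ℝ := fun x => 4 * t * B.indicator 1 x - (4 * t * β + 2 * t ^ 2) * G.indicator 1 x
  have hφ : Measurable φ := ((measurable_one.indicator hB).const_mul _).sub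
    ((measurable_one.indicator hG).const_mul _)
  have hsum (ω : Ω) : ∑ i, φ (D i ω) = 4 * t * hitCount (fun i => D i ω) B -
      (4 * t * β + 2 * t ^ 2) * hitCount (fun i => D i ω) G := by
    simp only [φ, hitCount_eq_sum_indicator, Finset.sum_sub_distrib, Finset.mul_sum]
  refine (measureReal_mono fun ω hω => ?_).trans
    (measureReal_le_sum_le_exp_neg (fun i => hφ.comp (hD i)) (hindep.comp (fun _ => φ) fun _ => hφ)
      (fun i => integrable_exp_mul_indicator_sub_mul_indicator (hD i hG) (hD i hB)
        (Set.preimage_mono hBG) _ _)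
      (fun i => mgf_excess_le_one (hD i hG) (hD i hB) (Set.preimage_mono hBG) hβ (hprob i) ht)
      (2 * m * t ^ 2))
  obtain ⟨hm, hexcess⟩ := hω
  simp only [Set.mem_ofPred_eq, Function.comp_apply, hsum]
  nlinarith [mul_le_mul_of_nonneg_left hexcess ht, mul_le_mul_of_nonneg_right hm (sq_nonneg t)]

theorem measureReal_hitCount_lt_half_le [IsProbabilityMeasure μ] {D : ι → Ω → T}
    (hD : ∀ i, Measurable (D i)) (hindep : iIndepFun D μ) {G : Set T} (hG : MeasurableSet G)
    (hr : r ∈ Set.Icc (0 : ℝ) 1) (hprob : ∀ i, r ≤ μ.real (D i ⁻¹' G)) :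
    μ.real {ω | hitCount (fun i => D i ω) G < Fintype.card ι * r / 2} ≤
      Real.exp (-(Fintype.card ι * r ^ 2 / 2)) := by
  have htail := measureReal_mul_hitCount_le_hitCount_le hD hindep MeasurableSet.univ hG.compl
    (Set.subset_univ _) (β := 1 - r) (m := Fintype.card ι) (t := r / 2)
    ⟨sub_nonneg.2 hr.2, sub_le_self _ hr.1⟩
    (fun i => by
      have h := hprob i
      rw [Set.preimage_compl, probReal_compl_eq_one_sub (hD i hG), Set.preimage_univ, probReal_univ]
      linarith) (by linarith [hr.1])
  simp only [hitCount_univ, hitCount_compl, le_refl, true_and] at htail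
  refine (measureReal_mono fun ω hω => ?_).trans (htail.trans_eq ?_)
  · have hω' : hitCount (fun i => D i ω) G < Fintype.card ι * r / 2 := hω
    simp only [Set.mem_ofPred_eq]
    linarith
  · congr 1
    ring

/-- The relative frequencies of the values of `f` among the hits of `G`; they are `0`, by division
by zero, if `G` is never hit. -/
noncomputable def condFreq {T S : Type*} (D : ι → T) (G : Set T) (f : T → S) (s : S) : ℝ :=
  hitCount D (G ∩ f ⁻¹' {s}) / hitCount D G

theorem sum_condFreq {T S : Type*} (D : ι → T) (G : Set T) (f : T → S) (U : Finset S) :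
    ∑ s ∈ U, condFreq D G f s = hitCount D (G ∩ f ⁻¹' U) / hitCount D G := by
  simp only [condFreq, ← Finset.sum_div, sum_hitCount_inter_preimage]

theorem condFreq_mem_stdSimplex {T S : Type*} [Fintype S] {D : ι → T} {G : Set T}
    (hG : hitCount D G ≠ 0) (f : T → S) : condFreq D G f ∈ stdSimplex ℝ S := by
  refine ⟨fun s => by unfold condFreq hitCount; positivity, ?_⟩
  rw [sum_condFreq, Finset.coe_univ, Set.preimage_univ, Set.inter_univ, div_self hG]

theorem measureReal_le_tvDist_le [IsFiniteMeasure μ] {S : Type*} [Fintype S] (E : Set Ω)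
    (V : Ω → S → ℝ) (P : S → ℝ) {q : ℝ}
    (hq : ∀ U : Finset S, μ.real {ω ∈ E | t ≤ ∑ s ∈ U, (V ω s - P s)} ≤ q) :
    μ.real {ω ∈ E | t ≤ tvDist (V ω) P} ≤ 2 ^ Fintype.card S * q := by
  have hcover : {ω ∈ E | t ≤ tvDist (V ω) P} ⊆
      ⋃ U : Finset S, {ω ∈ E | t ≤ ∑ s ∈ U, (V ω s - P s)} := by
    rintro ω ⟨hE, hω⟩
    obtain ⟨U, hU⟩ := exists_sum_sub_eq_tvDist (V ω) P
    exact Set.mem_iUnion.2 ⟨U, hE, hω.trans_eq hU.symm⟩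
  calc μ.real {ω ∈ E | t ≤ tvDist (V ω) P}
      ≤ ∑ U : Finset S, μ.real {ω ∈ E | t ≤ ∑ s ∈ U, (V ω s - P s)} :=
        (measureReal_mono hcover).trans (measureReal_iUnion_fintype_le _)
    _ ≤ ∑ _U : Finset S, q := Finset.sum_le_sum fun U _ => hq U
    _ = 2 ^ Fintype.card S * q := by simp

theorem one_sub_le_measureReal_inter_iInter [IsProbabilityMeasure μ] {E : Set Ω} {G : ι → Set Ω}
    {p q : ℝ} (hE : μ.real Eᶜ ≤ p) (hG : ∀ i, μ.real (G i)ᶜ ≤ q) :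
    1 - (p + Fintype.card ι * q) ≤ μ.real (E ∩ ⋂ i, G i) := by
  have hbad : μ.real (E ∩ ⋂ i, G i)ᶜ ≤ p + Fintype.card ι * q :=
    calc μ.real (E ∩ ⋂ i, G i)ᶜ = μ.real (Eᶜ ∪ ⋃ i, (G i)ᶜ) := by
          rw [Set.compl_inter, Set.compl_iInter]
      _ ≤ μ.real Eᶜ + ∑ i, μ.real (G i)ᶜ := (measureReal_union_le _ _).trans
          (add_le_add_right (measureReal_iUnion_fintype_le _) _)
      _ ≤ p + ∑ _i : ι, q := add_le_add hE (Finset.sum_le_sum fun i _ => hG i)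
      _ = p + Fintype.card ι * q := by
          rw [Finset.sum_const, Finset.card_univ, nsmul_eq_mul]
  have hone : 1 ≤ μ.real (E ∩ ⋂ i, G i) + μ.real (E ∩ ⋂ i, G i)ᶜ := by
    rw [← probReal_univ (μ := μ), ← Set.union_compl_self (E ∩ ⋂ i, G i)]
    exact measureReal_union_le _ _
  linarith

theorem sum_measureReal_inter_preimage_singleton [IsFiniteMeasure μ] {S : Type*} [MeasurableSpace S]
    [MeasurableSingletonClass S] (E : Set Ω) {g : Ω → S} (hg : Measurable g) (U : Finset S) :
    ∑ s ∈ U, μ.real (E ∩ g ⁻¹' {s}) = μ.real (E ∩ g ⁻¹' U) := by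
  have h := sum_measureReal_preimage_singleton (μ := μ.restrict E) U
    fun s _ => hg (measurableSet_singleton s)
  simpa only [measureReal_restrict_apply (hg (measurableSet_singleton _)),
    measureReal_restrict_apply (hg U.measurableSet), Set.inter_comm E] using h

theorem measureReal_le_tvDist_condFreq_le [IsProbabilityMeasure μ] {S : Type*} [Fintype S]
    [MeasurableSpace S] [MeasurableSingletonClass S] {D : ι → Ω → T} (hD : ∀ i, Measurable (D i))
    (hindep : iIndepFun D μ) {G : Set T} (hG : MeasurableSet G) {f : T → S} (hf : Measurable f)
    {P : S → ℝ} (hP : P ∈ stdSimplex ℝ S)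
    (hprob : ∀ i s, μ.real (D i ⁻¹' (G ∩ f ⁻¹' {s})) = μ.real (D i ⁻¹' G) * P s) (hm : 0 < m)
    (ht : 0 ≤ t) :
    μ.real {ω | m ≤ hitCount (fun i => D i ω) G ∧ t ≤ tvDist (condFreq (fun i => D i ω) G f) P} ≤
      2 ^ Fintype.card S * Real.exp (-(2 * m * t ^ 2)) := by
  refine measureReal_le_tvDist_le {ω | m ≤ hitCount (fun i => D i ω) G} _ P fun U => ?_
  refine (measureReal_mono ?_).trans (measureReal_mul_hitCount_le_hitCount_le hD hindep hG
    (hG.inter (hf U.measurableSet)) Set.inter_subset_left (β := ∑ s ∈ U, P s)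
    ⟨Finset.sum_nonneg fun s _ => hP.1 s, ?_⟩ (fun i => le_of_eq ?_) ht)
  · rintro ω ⟨hmω, hω⟩
    refine ⟨hmω, ?_⟩
    have hpos : 0 < hitCount (fun i => D i ω) G := hm.trans_le hmω
    rw [Finset.sum_sub_distrib, sum_condFreq] at hω
    rw [← le_div_iff₀ hpos]
    linarith
  · exact (Finset.sum_le_univ_sum_of_nonneg hP.1).trans_eq hP.2
  · have hsum := sum_measureReal_inter_preimage_singleton (μ := μ) (D i ⁻¹' G) (hf.comp (hD i)) U
    simp only [Set.preimage_comp, ← Set.preimage_inter, hprob, ← Finset.mul_sum] at hsum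
    rw [← hsum, mul_comm]

end Concentration

section Radius

/-- A confidence radius for the total variation distance between a distribution on `k` points and
its empirical version from `N` samples, at failure probability `η`. -/
noncomputable def tvRadius (k : ℕ) (N η : ℝ) : ℝ := √(2 * Real.log η⁻¹ / N) + √(k / N)

theorem tvRadius_nonneg (k : ℕ) (N η : ℝ) : 0 ≤ tvRadius k N η := by
  unfold tvRadius
  positivity

theorem two_pow_mul_exp_neg_sq_tvRadius_le {N η : ℝ} (hN : 0 < N) (hη : 0 < η) (hη' : η ≤ 1)
    (k : ℕ) : 2 ^ k * Real.exp (-(2 * N * tvRadius k N η ^ 2)) ≤ η := by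
  have hlog : 0 ≤ Real.log η⁻¹ := Real.log_nonneg ((one_le_inv₀ hη).2 hη')
  have hsq : 2 * Real.log η⁻¹ + k ≤ N * tvRadius k N η ^ 2 := by
    rw [← div_le_iff₀' hN, add_div, tvRadius, add_sq, Real.sq_sqrt (by positivity),
      Real.sq_sqrt (by positivity)]
    exact add_le_add_left (le_add_of_nonneg_right (by positivity)) _
  have htwo : (2 : ℝ) ^ k ≤ Real.exp k := by
    rw [← Real.exp_one_pow]
    exact pow_le_pow_left₀ zero_le_two (by linarith [Real.add_one_le_exp 1]) k
  calc 2 ^ k * Real.exp (-(2 * N * tvRadius k N η ^ 2))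
      ≤ Real.exp k * Real.exp (-(2 * N * tvRadius k N η ^ 2)) :=
        mul_le_mul_of_nonneg_right htwo (Real.exp_pos _).le
    _ = Real.exp (k - 2 * N * tvRadius k N η ^ 2) := by rw [← Real.exp_add, sub_eq_add_neg]
    _ ≤ Real.exp (-Real.log η⁻¹) :=
        Real.exp_le_exp.2 (by linarith [Nat.cast_nonneg (α := ℝ) k])
    _ = η := by rw [Real.log_inv, neg_neg, Real.exp_log hη]

theorem sqrt_add_le_sqrt_add_sqrt {x y : ℝ} (hx : 0 ≤ x) (hy : 0 ≤ y) : √(x + y) ≤ √x + √y := by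
  rw [Real.sqrt_le_iff, add_sq, Real.sq_sqrt hx, Real.sq_sqrt hy]
  exact ⟨by positivity, add_le_add_left (le_add_of_nonneg_right (by positivity)) _⟩

theorem tvRadius_le_mul_sqrt_add_sqrt {k : ℕ} {n ρ η L s : ℝ} (hn : 0 ≤ n) (hρ : 0 < ρ)
    (hL : 0 ≤ L) (hk : k ≤ s) (hη : Real.log η⁻¹ ≤ 2 * (L + s)) :
    tvRadius k (n * ρ) η ≤ 3 / √ρ * (√(L / n) + √(s / n)) := by
  have hs : 0 ≤ s := (Nat.cast_nonneg k).trans hk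
  have hlog : √(2 * Real.log η⁻¹ / (n * ρ)) ≤ 2 / √ρ * (√(L / n) + √(s / n)) :=
    calc √(2 * Real.log η⁻¹ / (n * ρ)) ≤ √(2 ^ 2 / ρ * (L / n + s / n)) :=
          Real.sqrt_le_sqrt <| by
            rw [← add_div, div_mul_div_comm, mul_comm n ρ]
            exact div_le_div_of_nonneg_right (by linarith) (by positivity)
      _ = 2 / √ρ * √(L / n + s / n) := by
          rw [Real.sqrt_mul (by positivity), Real.sqrt_div (by positivity),
            Real.sqrt_sq zero_le_two]
      _ ≤ 2 / √ρ * (√(L / n) + √(s / n)) := mul_le_mul_of_nonneg_left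
          (sqrt_add_le_sqrt_add_sqrt (by positivity) (by positivity)) (by positivity)
  have hcard : √(k / (n * ρ)) ≤ 1 / √ρ * √(s / n) := by
    rw [← div_div, Real.sqrt_div (by positivity), one_div_mul_eq_div]
    gcongr
  calc tvRadius k (n * ρ) η ≤ 2 / √ρ * (√(L / n) + √(s / n)) + 1 / √ρ * √(s / n) :=
        add_le_add hlog hcard
    _ = 3 / √ρ * (√(L / n) + √(s / n)) - 1 / √ρ * √(L / n) := by ring
    _ ≤ 3 / √ρ * (√(L / n) + √(s / n)) := sub_le_self _ (by positivity)

theorem opeBound_eq_mul_tvRadius_add_tvRadius (Ymax μπ μx δ : ℝ) (n cX cA cZ : ℕ) :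
    opeBound Ymax μπ μx δ n cX cA cZ = Ymax * (tvRadius cX n (δ / 2) +
      tvRadius cZ (n * (μπ * μx) / 2) (δ / (4 * cX * cA))) := by
  have hdiv (p q : ℝ) : p / (q / 2) = 2 * p / q := by rw [div_div_eq_mul_div, mul_comm]
  simp only [opeBound, tvRadius, inv_div, hdiv, add_assoc]
  ring_nf

theorem opeBound_le {Ymax μπ μx δ : ℝ} {cX cA : ℕ} (hY : 0 ≤ Ymax) (hμ : 0 < μπ * μx) (hδ : 0 < δ)
    (hδ' : δ ≤ 1) (hX : 0 < cX) (hA : 0 < cA) (n cZ : ℕ) :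
    opeBound Ymax μπ μx δ n cX cA cZ ≤ 3 * Ymax * (1 + 1 / √(μπ * μx / 2)) *
      (√(Real.log (cX * cA / δ) / n) + √(((cX : ℝ) + cZ) / n)) := by
  have hX' : (1 : ℝ) ≤ cX := Nat.one_le_cast.2 hX
  have hA' : (1 : ℝ) ≤ cA := Nat.one_le_cast.2 hA
  have hZ : (0 : ℝ) ≤ cZ := Nat.cast_nonneg cZ
  have hXA : 1 ≤ (cX : ℝ) * cA := one_le_mul_of_one_le_of_one_le hX' hA'
  have hL : 0 ≤ Real.log (cX * cA / δ) := Real.log_nonneg ((one_le_div hδ).2 (hδ'.trans hXA))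
  have hlog2 := Real.log_two_lt_d9
  have hcontext : Real.log (δ / 2)⁻¹ ≤ 2 * (Real.log (cX * cA / δ) + (cX + cZ)) := by
    have : Real.log (δ / 2)⁻¹ ≤ Real.log 2 + Real.log (cX * cA / δ) := by
      rw [← Real.log_mul (by positivity) (by positivity), inv_div, ← mul_div_assoc]
      gcongr
      linarith
    linarith
  have houtcome : Real.log (δ / (4 * cX * cA))⁻¹ ≤ 2 * (Real.log (cX * cA / δ) + (cX + cZ)) := by
    have : Real.log (δ / (4 * cX * cA))⁻¹ = 2 * Real.log 2 + Real.log (cX * cA / δ) := by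
      rw [inv_div, mul_assoc, mul_div_assoc, Real.log_mul (by norm_num) (by positivity)]
      congr 1
      rw [show (4 : ℝ) = 2 ^ 2 by norm_num, Real.log_pow, Nat.cast_ofNat]
    linarith
  have hn : (0 : ℝ) ≤ n := Nat.cast_nonneg n
  have hcontext' := tvRadius_le_mul_sqrt_add_sqrt hn one_pos hL (le_add_of_nonneg_right hZ) hcontext
  have houtcome' := tvRadius_le_mul_sqrt_add_sqrt hn (half_pos hμ) hL
    (le_add_of_nonneg_left (zero_le_one.trans hX')) houtcome
  rw [mul_one, Real.sqrt_one] at hcontext'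
  rw [opeBound_eq_mul_tvRadius_add_tvRadius, mul_div_assoc]
  refine (mul_le_mul_of_nonneg_left (add_le_add hcontext' houtcome') hY).trans_eq ?_
  ring

end Radius

section LoggedData

variable {X A Z : Type*} {n : ℕ}

/-- The set of triples (context, action, outcome) with context `x` and action `a`. -/
def cell (x : X) (a : A) : Set (X × A × Z) := {w | w.1 = x ∧ w.2.1 = a}

theorem empContext_eq_condFreq (D : Fin n → X × A × Z) :
    empContext D = condFreq D Set.univ Prod.fst := by
  funext x
  rw [condFreq, Set.univ_inter, hitCount_univ, Fintype.card_fin]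
  rfl

theorem cell_inter_preimage_singleton (x : X) (a : A) (z : Z) :
    cell x a ∩ (fun w => w.2.2) ⁻¹' {z} = {(x, a, z)} := by
  ext w
  simp [cell, Prod.ext_iff, and_assoc]

theorem empOutcome_eq_condFreq (D : Fin n → X × A × Z) (x : X) (a : A) :
    empOutcome D x a = condFreq D (cell x a) fun w => w.2.2 := by
  funext z
  rw [condFreq, cell_inter_preimage_singleton]
  simp only [empOutcome, hitCount]
  congr

theorem abs_empPolicyValue_sub_policyValue_le {d e : ℕ} {𝒳 : Finset (EuclideanSpace ℝ (Fin d))}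
    {Ξ : Finset (EuclideanSpace ℝ (Fin e))} [Fintype A] {εx εc l u s t : ℝ}
    {D : Fin n → 𝒳 × A × Ξ} {P₀ : 𝒳 → ℝ} {Q₀ y : 𝒳 → A → Ξ → ℝ} {π : 𝒳 → A → ℝ}
    (hεx : 0 < εx) (hεc : 0 < εc) (hP₀ : P₀ ∈ stdSimplex ℝ 𝒳)
    (hQ₀ : ∀ x a, Q₀ x a ∈ stdSimplex ℝ Ξ) (hπ : ∀ x, π x ∈ stdSimplex ℝ A)
    (hy : ∀ x a ξ, y x a ξ ∈ Set.Icc l u) (hcell : ∀ x a, hitCount D (cell x a) ≠ 0)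
    (hs : tvDist (empContext D) P₀ ≤ s) (ht : ∀ x a, tvDist (empOutcome D x a) (Q₀ x a) ≤ t) :
    |empPolicyValue εx εc D y π - policyValue εx εc P₀ Q₀ y π| ≤ (u - l) * (s + t) := by
  obtain ⟨x₀⟩ := nonempty_of_mem_stdSimplex hP₀
  obtain ⟨a₀⟩ := nonempty_of_mem_stdSimplex (hπ x₀)
  obtain ⟨ξ₀⟩ := nonempty_of_mem_stdSimplex (hQ₀ x₀ a₀)
  have hlu : 0 ≤ u - l := sub_nonneg.2 ((hy x₀ a₀ ξ₀).1.trans (hy x₀ a₀ ξ₀).2)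
  have hn : n ≠ 0 := by
    rintro rfl
    exact hcell x₀ a₀ (by simp [hitCount])
  have hcontext : empContext D ∈ stdSimplex ℝ 𝒳 := by
    rw [empContext_eq_condFreq]
    exact condFreq_mem_stdSimplex (by simpa [hitCount_univ] using hn) _
  have houtcome (x : 𝒳) (a : A) : empOutcome D x a ∈ stdSimplex ℝ Ξ := by
    rw [empOutcome_eq_condFreq]
    exact condFreq_mem_stdSimplex (hcell x a) _
  exact (abs_dualDRO_sub_policyValue_le hεx hεc hcontext hP₀ houtcome hQ₀ hπ hy ht).trans
    (mul_le_mul_of_nonneg_left (add_le_add_left hs t) hlu)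

variable {Ω : Type*} [MeasurableSpace X] [MeasurableSpace A] [MeasurableSpace Z]
  [MeasurableSpace Ω] {μ : Measure Ω} {P₀ : X → ℝ} {π₀ : X → A → ℝ}
  {Q₀ : X → A → Z → ℝ} {D : Fin n → Ω → X × A × Z} {m t r η δ : ℝ}

theorem measurableSet_cell [MeasurableSingletonClass X] [MeasurableSingletonClass A] (x : X)
    (a : A) : MeasurableSet (cell x a : Set (X × A × Z)) :=
  (measurable_fst (measurableSet_singleton x)).inter
    ((measurable_fst.comp measurable_snd) (measurableSet_singleton a))

namespace IsLoggedData

theorem measureReal_preimage_cell_inter (h : IsLoggedData P₀ π₀ Q₀ μ D) (i : Fin n) (x : X) (a : A)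
    (z : Z) : μ.real (D i ⁻¹' (cell x a ∩ (fun w => w.2.2) ⁻¹' {z})) =
      P₀ x * π₀ x a * Q₀ x a z := by
  rw [cell_inter_preimage_singleton]
  exact h.2.2 i x a z

variable [IsProbabilityMeasure μ]

theorem measureReal_preimage_cell [Fintype Z] [MeasurableSingletonClass Z]
    (h : IsLoggedData P₀ π₀ Q₀ μ D) (hQ₀ : ∀ x a, Q₀ x a ∈ stdSimplex ℝ Z) (i : Fin n) (x : X)
    (a : A) : μ.real (D i ⁻¹' cell x a) = P₀ x * π₀ x a := by
  have hsum := sum_measureReal_inter_preimage_singleton (μ := μ) (D i ⁻¹' cell x a)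
    (measurable_snd.snd.comp (h.1 i)) Finset.univ
  rw [Finset.coe_univ, Set.preimage_univ, Set.inter_univ] at hsum
  rw [← hsum, ← mul_one (P₀ x * π₀ x a), ← (hQ₀ x a).2, Finset.mul_sum]
  exact Finset.sum_congr rfl fun z _ => h.measureReal_preimage_cell_inter i x a z

theorem measureReal_preimage_fst [Fintype A] [MeasurableSingletonClass A] [Fintype Z]
    [MeasurableSingletonClass Z] (h : IsLoggedData P₀ π₀ Q₀ μ D)
    (hπ₀ : ∀ x, π₀ x ∈ stdSimplex ℝ A) (hQ₀ : ∀ x a, Q₀ x a ∈ stdSimplex ℝ Z) (i : Fin n) (x : X) :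
    μ.real (D i ⁻¹' (Prod.fst ⁻¹' {x})) = P₀ x := by
  have hsum := sum_measureReal_inter_preimage_singleton (μ := μ) (D i ⁻¹' (Prod.fst ⁻¹' {x}))
    (measurable_snd.fst.comp (h.1 i)) Finset.univ
  rw [Finset.coe_univ, Set.preimage_univ, Set.inter_univ] at hsum
  rw [← hsum, ← mul_one (P₀ x), ← (hπ₀ x).2, Finset.mul_sum]
  exact Finset.sum_congr rfl fun a _ => h.measureReal_preimage_cell hQ₀ i x a

variable [MeasurableSingletonClass X] [MeasurableSingletonClass A] [Fintype Z]
  [MeasurableSingletonClass Z]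

theorem measureReal_le_tvDist_empContext_le [Fintype X] [Fintype A] (h : IsLoggedData P₀ π₀ Q₀ μ D)
    (hn : 0 < n) (hP₀ : P₀ ∈ stdSimplex ℝ X) (hπ₀ : ∀ x, π₀ x ∈ stdSimplex ℝ A)
    (hQ₀ : ∀ x a, Q₀ x a ∈ stdSimplex ℝ Z) (ht : 0 ≤ t) :
    μ.real {ω | t ≤ tvDist (empContext fun i => D i ω) P₀} ≤
      2 ^ Fintype.card X * Real.exp (-(2 * n * t ^ 2)) := by
  have htail := measureReal_le_tvDist_condFreq_le h.1 h.2.1 MeasurableSet.univ measurable_fst hP₀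
    (fun i x => by
      rw [Set.univ_inter, h.measureReal_preimage_fst hπ₀ hQ₀, Set.preimage_univ, probReal_univ,
        one_mul])
    (Nat.cast_pos.2 hn) ht
  simpa only [hitCount_univ, Fintype.card_fin, le_refl, true_and, ← empContext_eq_condFreq]
    using htail

theorem measureReal_le_tvDist_empOutcome_le (h : IsLoggedData P₀ π₀ Q₀ μ D)
    (hQ₀ : ∀ x a, Q₀ x a ∈ stdSimplex ℝ Z) (x : X) (a : A) (hm : 0 < m) (ht : 0 ≤ t) :
    μ.real {ω | m ≤ hitCount (fun i => D i ω) (cell x a) ∧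
        t ≤ tvDist (empOutcome (fun i => D i ω) x a) (Q₀ x a)} ≤
      2 ^ Fintype.card Z * Real.exp (-(2 * m * t ^ 2)) := by
  have htail := measureReal_le_tvDist_condFreq_le h.1 h.2.1 (measurableSet_cell x a)
    measurable_snd.snd (hQ₀ x a)
    (fun i z => by
      rw [h.measureReal_preimage_cell_inter, h.measureReal_preimage_cell hQ₀])
    hm ht
  simpa only [← empOutcome_eq_condFreq] using htail

theorem measureReal_compl_tvDist_empContext_le [Fintype X] [Fintype A]
    (h : IsLoggedData P₀ π₀ Q₀ μ D) (hn : 0 < n) (hP₀ : P₀ ∈ stdSimplex ℝ X)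
    (hπ₀ : ∀ x, π₀ x ∈ stdSimplex ℝ A) (hQ₀ : ∀ x a, Q₀ x a ∈ stdSimplex ℝ Z) (hη : 0 < η)
    (hη' : η ≤ 1) :
    μ.real {ω | tvDist (empContext fun i => D i ω) P₀ ≤ tvRadius (Fintype.card X) n η}ᶜ ≤ η := by
  refine (measureReal_mono fun ω hω => ?_).trans <|
    (h.measureReal_le_tvDist_empContext_le hn hP₀ hπ₀ hQ₀ (tvRadius_nonneg _ _ _)).trans <|
      two_pow_mul_exp_neg_sq_tvRadius_le (Nat.cast_pos.2 hn) hη hη' _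
  rw [Set.mem_compl_iff, Set.mem_ofPred_eq, not_le] at hω
  exact hω.le

theorem measureReal_compl_tvDist_empOutcome_le (h : IsLoggedData P₀ π₀ Q₀ μ D) (hn : 0 < n)
    (hQ₀ : ∀ x a, Q₀ x a ∈ stdSimplex ℝ Z) {x : X} {a : A} (hr : 0 < r)
    (hcell : r ≤ P₀ x * π₀ x a) (hη : 0 < η) (hη' : η ≤ 1)
    (hsize : 2 * Real.log η⁻¹ / r ^ 2 ≤ n) :
    μ.real {ω | 0 < hitCount (fun i => D i ω) (cell x a) ∧
      tvDist (empOutcome (fun i => D i ω) x a) (Q₀ x a) ≤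
        tvRadius (Fintype.card Z) (n * r / 2) η}ᶜ ≤ 2 * η := by
  have hprob (i : Fin n) : r ≤ μ.real (D i ⁻¹' cell x a) :=
    hcell.trans_eq (h.measureReal_preimage_cell hQ₀ i x a).symm
  have hhalf : 0 < n * r / 2 := by positivity
  have hfew := measureReal_hitCount_lt_half_le h.1 h.2.1 (measurableSet_cell x a)
    ⟨hr.le, (hprob ⟨0, hn⟩).trans measureReal_le_one⟩ hprob
  have hfar := (h.measureReal_le_tvDist_empOutcome_le hQ₀ x a hhalf (tvRadius_nonneg _ _ _)).trans
    (two_pow_mul_exp_neg_sq_tvRadius_le hhalf hη hη' (Fintype.card Z))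
  rw [Fintype.card_fin] at hfew
  have hexp : Real.exp (-(n * r ^ 2 / 2)) ≤ η := by
    rw [div_le_iff₀ (by positivity), Real.log_inv] at hsize
    rw [← Real.le_log_iff_exp_le hη]
    linarith
  refine (measureReal_mono fun ω hω => ?_).trans <| (measureReal_union_le _ _).trans <|
    (add_le_add (hfew.trans hexp) hfar).trans_eq (two_mul η).symm
  rw [Set.mem_compl_iff, Set.mem_ofPred_eq, not_and, not_le] at hω
  rcases lt_or_ge (hitCount (fun i => D i ω) (cell x a)) (n * r / 2) with hlt | hge
  · exact Or.inl hlt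
  · exact Or.inr ⟨hge, (hω (hhalf.trans_le hge)).le⟩

theorem one_sub_le_measureReal_tvDist_le [Fintype X] [Fintype A] (h : IsLoggedData P₀ π₀ Q₀ μ D)
    (hP₀ : P₀ ∈ stdSimplex ℝ X) (hπ₀ : ∀ x, π₀ x ∈ stdSimplex ℝ A)
    (hQ₀ : ∀ x a, Q₀ x a ∈ stdSimplex ℝ Z) (hr : 0 < r) (hcell : ∀ x a, r ≤ P₀ x * π₀ x a)
    (hδ : 0 < δ) (hδ' : δ ≤ 1)
    (hn : 2 * Real.log (4 * Fintype.card X * Fintype.card A / δ) / r ^ 2 ≤ n) :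
    1 - δ ≤ μ.real {ω |
      tvDist (empContext fun i => D i ω) P₀ ≤ tvRadius (Fintype.card X) n (δ / 2) ∧
      ∀ x a, 0 < hitCount (fun i => D i ω) (cell x a) ∧
        tvDist (empOutcome (fun i => D i ω) x a) (Q₀ x a) ≤
          tvRadius (Fintype.card Z) (n * r / 2) (δ / (4 * Fintype.card X * Fintype.card A))} := by
  obtain ⟨x₀⟩ := nonempty_of_mem_stdSimplex hP₀
  obtain ⟨a₀⟩ := nonempty_of_mem_stdSimplex (hπ₀ x₀)
  have hX : (1 : ℝ) ≤ Fintype.card X := Nat.one_le_cast.2 (Fintype.card_pos_iff.2 ⟨x₀⟩)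
  have hA : (1 : ℝ) ≤ Fintype.card A := Nat.one_le_cast.2 (Fintype.card_pos_iff.2 ⟨a₀⟩)
  have hXA := one_le_mul_of_one_le_of_one_le hX hA
  set η := δ / (4 * Fintype.card X * Fintype.card A) with hη_def
  have hη : 0 < η := by positivity
  have hη' : η < 1 := by
    rw [div_lt_one (by positivity)]
    linarith
  rw [← inv_div δ, ← hη_def] at hn
  have hn0 : 0 < n := Nat.cast_pos.1 <| hn.trans_lt' <|
    div_pos (mul_pos two_pos (Real.log_pos ((one_lt_inv₀ hη).2 hη'))) (by positivity)
  have htotal : δ / 2 + Fintype.card (X × A) * (2 * η) = δ := by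
    rw [Fintype.card_prod, hη_def]
    push_cast
    field_simp
    norm_num
  have hgood := one_sub_le_measureReal_inter_iInter (ι := X × A)
    (h.measureReal_compl_tvDist_empContext_le hn0 hP₀ hπ₀ hQ₀ (half_pos hδ) (by linarith))
    fun p => h.measureReal_compl_tvDist_empOutcome_le hn0 hQ₀ hr (hcell p.1 p.2) hη hη'.le hn
  rw [htotal] at hgood
  refine hgood.trans (measureReal_mono ?_)
  exact fun ω hω => ⟨hω.1, fun x a => Set.mem_iInter.1 hω.2 (x, a)⟩

end IsLoggedData

end LoggedData

theorem mainTheorem1 (Ymax μπ μx : ℝ) (hμπ : 0 < μπ) (hμx : 0 < μx) :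
    -- the constant in the rate depends on `Ymax`, `μπ`, `μx` only
    ∃ C : ℝ, 0 ≤ C ∧
      ∀ (d e : ℕ) (𝒳 : Finset (EuclideanSpace ℝ (Fin d))) (Ξ : Finset (EuclideanSpace ℝ (Fin e)))
        (A : Type*) [Fintype A] [MeasurableSpace A] [MeasurableSingletonClass A]
        (P₀ : 𝒳 → ℝ) (π₀ : 𝒳 → A → ℝ) (Q₀ : 𝒳 → A → Ξ → ℝ) (y : 𝒳 → A → Ξ → ℝ)
        (π : 𝒳 → A → ℝ) (εx εc δ : ℝ) (n : ℕ)
        (Ω : Type*) [MeasurableSpace Ω] (μ : Measure Ω) [IsProbabilityMeasure μ]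
        (D : Fin n → Ω → 𝒳 × A × Ξ),
        P₀ ∈ stdSimplex ℝ 𝒳 →
        (∀ x, π₀ x ∈ stdSimplex ℝ A) →
        (∀ x a, Q₀ x a ∈ stdSimplex ℝ Ξ) →
        (∀ x, π x ∈ stdSimplex ℝ A) →
        (∀ x a, μπ ≤ π₀ x a) →
        (∀ x, μx ≤ P₀ x) →
        (∀ x a ξ, 0 ≤ y x a ξ ∧ y x a ξ ≤ Ymax) →
        0 < εx → 0 < εc → 0 < δ → δ < 1 →
        IsLoggedData P₀ π₀ Q₀ μ D →
        2 * Real.log (4 * 𝒳.card * Fintype.card A / δ) / (μπ * μx) ^ 2 ≤ n →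
        1 - δ ≤ μ.real {ω | |empPolicyValue εx εc (fun i => D i ω) y π
              - policyValue εx εc P₀ Q₀ y π|
            ≤ opeBound Ymax μπ μx δ n 𝒳.card (Fintype.card A) Ξ.card} ∧
        opeBound Ymax μπ μx δ n 𝒳.card (Fintype.card A) Ξ.card
          ≤ C * √(Real.log (𝒳.card * Fintype.card A / δ) / n)
            + C * √(((𝒳.card : ℝ) + Ξ.card) / n) := by
  refine ⟨3 * |Ymax| * (1 + 1 / √(μπ * μx / 2)), by positivity, ?_⟩
  intro d e 𝒳 Ξ A _ _ _ P₀ π₀ Q₀ y π εx εc δ n Ω _ μ _ D hP₀ hπ₀ hQ₀ hπ hμπ₀ hμP₀ hy hεx hεc hδ hδ'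
    hD hn
  obtain ⟨x₀⟩ := nonempty_of_mem_stdSimplex hP₀
  obtain ⟨a₀⟩ := nonempty_of_mem_stdSimplex (hπ x₀)
  obtain ⟨ξ₀⟩ := nonempty_of_mem_stdSimplex (hQ₀ x₀ a₀)
  have hYmax : 0 ≤ Ymax := (hy x₀ a₀ ξ₀).1.trans (hy x₀ a₀ ξ₀).2
  have hμ : 0 < μπ * μx := mul_pos hμπ hμx
  have hcell (x : 𝒳) (a : A) : μπ * μx ≤ P₀ x * π₀ x a :=
    (mul_le_mul (hμπ₀ x a) (hμP₀ x) hμx.le ((hπ₀ x).1 a)).trans_eq (mul_comm _ _)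
  rw [← Fintype.card_coe 𝒳] at hn ⊢
  rw [← Fintype.card_coe Ξ]
  constructor
  · refine (hD.one_sub_le_measureReal_tvDist_le hP₀ hπ₀ hQ₀ hμ hcell hδ hδ'.le hn).trans
      (measureReal_mono fun ω ⟨hcontext, houtcome⟩ => ?_)
    rw [Set.mem_ofPred_eq, opeBound_eq_mul_tvRadius_add_tvRadius, ← sub_zero Ymax]
    exact abs_empPolicyValue_sub_policyValue_le hεx hεc hP₀ hQ₀ hπ hy
      (fun x a => (houtcome x a).1.ne') hcontext fun x a => (houtcome x a).2
  · rw [abs_of_nonneg hYmax, ← mul_add]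
    exact opeBound_le hYmax hμ hδ hδ'.le (Fintype.card_pos_iff.2 ⟨x₀⟩)
      (Fintype.card_pos_iff.2 ⟨a₀⟩) n (Fintype.card Ξ)
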